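/- Let $F$ be a field of characteristic $\ne 2$, let $r\ge 1$, and let $\omega_a\in F$ ($a\ge 0$) and $u_1,\dots,u_r\in F$ be parameters such that the $u_i$ are distinct and $u_i+u_j\ne 0$ for all $i,j$ (including $i=j$). Let $W=W_{2,F}$ be the two-strand degenerate cyclotomic BMW algebra over $F$ with these parameters, that is, the unital associative $F$-algebra with generators $s_1,e_1,x_1,x_2$ and relations $$s_1^2=1,\quad e_1^2=\omega_0e_1,\quad x_1x_2=x_2x_1,\quad s_1x_1-x_2s_1=e_1-1=x_1s_1-s_1x_2,$$ $$e_1x_1^ae_1=\omega_ae_1\ (a>0),\quad e_1s_1=e_1=s_1e_1,\quad e_1(x_1+x_2)=0=(x_1+x_2)e_1,$$ $$(x_1-u_1)(x_1-u_2)\cdots(x_1-u_r)=0.$$ Then the following conditions are equivalent: 1. The elements $e_1,x_1e_1,\dots,x_1^{r-1}e_1$ of $We_1$ are linearly independent over $F$, and $e_1We_1\ne 0$. 2. For all $a\ge 0$, $\omega_a=\sum_{i=1}^r\gamma_iu_i^a$, where $$\gamma_i=(2u_i-(-1)^r)\prod_{j\ne i}\frac{u_i+u_j}{u_i-u_j},$$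 and $\omega_a\neq 0$ for some $a \ge 0$. 3. $W$ admits a (left) module $M$ that has an $F$-basis $v_0,x_1v_0,\dots,x_1^{r-1}v_0$ and satisfies $e_1M=Fv_0$. -/

import Mathlib

open scoped BigOperators

universe v

noncomputable section

namespace DegBMW

/-- Generators of the degenerate affine BMW algebra on `n` strands. Indices are shifted by one:
`s i`, `e i` with `i : Fin (n - 1)` stand for `s_{i+1}`, `e_{i+1}`, and `x j` with `j : Fin n`
stands for `x_{j+1}`. -/
inductive Gen (n : ℕ) : Type
  | s (i : Fin (n - 1)) : Gen n
  | e (i : Fin (n - 1)) : Gen n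
  | x (j : Fin n) : Gen n

/-- The strand `i`, for an index `i` with `1 ≤ i < n`. -/
def lo {n : ℕ} (i : Fin (n - 1)) : Fin n := ⟨i.val, by omega⟩

/-- The strand `i + 1`, for an index `i` with `1 ≤ i < n`. -/
def hi {n : ℕ} (i : Fin (n - 1)) : Fin n := ⟨i.val + 1, by omega⟩

section Free

variable (R : Type v) [CommRing R] {n : ℕ}

/-- The free generator `s_i`. -/
abbrev fs (i : Fin (n - 1)) : FreeAlgebra R (Gen n) := FreeAlgebra.ι R (Gen.s i)

/-- The free generator `e_i`. -/
abbrev fe (i : Fin (n - 1)) : FreeAlgebra R (Gen n) := FreeAlgebra.ι R (Gen.e i)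

/-- The free generator `x_j`. -/
abbrev fx (j : Fin n) : FreeAlgebra R (Gen n) := FreeAlgebra.ι R (Gen.x j)

end Free

/-- `Far i j` says `|i - j| > 1`. -/
def Far {n : ℕ} (i j : Fin (n - 1)) : Prop := i.val + 1 < j.val ∨ j.val + 1 < i.val

/-- The defining relations of the degenerate affine BMW algebra on `n` strands with
parameters `ω a`, `a ≥ 0`. A hypothesis `k.val = i.val + 1` says that `k` is the index `i + 1`. -/
inductive AffRel {R : Type v} [CommRing R] (n : ℕ) (ω : ℕ → R) :
    FreeAlgebra R (Gen n) → FreeAlgebra R (Gen n) → Prop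
  -- involutions
  | s_sq (i : Fin (n - 1)) : AffRel n ω (fs R i ^ 2) 1
  -- affine braid relations
  | s_comm (i j : Fin (n - 1)) (h : Far i j) : AffRel n ω (fs R i * fs R j) (fs R j * fs R i)
  | braid (i k : Fin (n - 1)) (h : k.val = i.val + 1) :
      AffRel n ω (fs R i * fs R k * fs R i) (fs R k * fs R i * fs R k)
  | s_x_comm (i : Fin (n - 1)) (j : Fin n) (h₁ : j ≠ lo i) (h₂ : j ≠ hi i) :
      AffRel n ω (fs R i * fx R j) (fx R j * fs R i)
  -- idempotent relations
  | e_sq (i : Fin (n - 1)) : AffRel n ω (fe R i ^ 2) (ω 0 • fe R i)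
  -- commutation relations
  | s_e_comm (i j : Fin (n - 1)) (h : Far i j) : AffRel n ω (fs R i * fe R j) (fe R j * fs R i)
  | e_comm (i j : Fin (n - 1)) (h : Far i j) : AffRel n ω (fe R i * fe R j) (fe R j * fe R i)
  | e_x_comm (i : Fin (n - 1)) (j : Fin n) (h₁ : j ≠ lo i) (h₂ : j ≠ hi i) :
      AffRel n ω (fe R i * fx R j) (fx R j * fe R i)
  | x_comm (i j : Fin n) : AffRel n ω (fx R i * fx R j) (fx R j * fx R i)
  -- skein relations
  | skein_left (i : Fin (n - 1)) :
      AffRel n ω (fs R i * fx R (lo i) - fx R (hi i) * fs R i) (fe R i - 1)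
  | skein_right (i : Fin (n - 1)) :
      AffRel n ω (fx R (lo i) * fs R i - fs R i * fx R (hi i)) (fe R i - 1)
  -- unwrapping relations: here `i` is the first index
  | unwrap (i : Fin (n - 1)) (h : i.val = 0) (a : ℕ) (ha : 0 < a) :
      AffRel n ω (fe R i * fx R (lo i) ^ a * fe R i) (ω a • fe R i)
  -- tangle relations
  | e_s (i : Fin (n - 1)) : AffRel n ω (fe R i * fs R i) (fe R i)
  | s_e (i : Fin (n - 1)) : AffRel n ω (fs R i * fe R i) (fe R i)
  | tangle₁ (i k : Fin (n - 1)) (h : k.val = i.val + 1) :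
      AffRel n ω (fs R i * fe R k * fe R i) (fs R k * fe R i)
  | tangle₂ (i k : Fin (n - 1)) (h : k.val = i.val + 1) :
      AffRel n ω (fe R i * fe R k * fs R i) (fe R i * fs R k)
  | tangle₃ (i k : Fin (n - 1)) (h : k.val = i.val + 1) :
      AffRel n ω (fe R k * fe R i * fs R k) (fe R k * fs R i)
  | tangle₄ (i k : Fin (n - 1)) (h : k.val = i.val + 1) :
      AffRel n ω (fs R k * fe R i * fe R k) (fs R i * fe R k)
  -- untwisting relations
  | untwist₁ (i k : Fin (n - 1)) (h : k.val = i.val + 1) :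
      AffRel n ω (fe R k * fe R i * fe R k) (fe R k)
  | untwist₂ (i k : Fin (n - 1)) (h : k.val = i.val + 1) :
      AffRel n ω (fe R i * fe R k * fe R i) (fe R i)
  -- anti-symmetry relations
  | anti_right (i : Fin (n - 1)) : AffRel n ω (fe R i * (fx R (lo i) + fx R (hi i))) 0
  | anti_left (i : Fin (n - 1)) : AffRel n ω ((fx R (lo i) + fx R (hi i)) * fe R i) 0

/-- The degenerate affine BMW algebra on `n` strands. -/
abbrev Waff {R : Type v} [CommRing R] (n : ℕ) (ω : ℕ → R) : Type v := RingQuot (AffRel n ω)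

/-- The generator `x_j` of the degenerate affine BMW algebra. -/
def Waff.x {R : Type v} [CommRing R] {n : ℕ} (ω : ℕ → R) (j : Fin n) : Waff n ω :=
  RingQuot.mkAlgHom R (AffRel n ω) (fx R j)

/-- The cyclotomic relation `(x_1 - u_1) ⋯ (x_1 - u_r) = 0`; here `j` is the first strand. -/
inductive CycRel {R : Type v} [CommRing R] (n : ℕ) (ω : ℕ → R) {r : ℕ} (u : Fin r → R) :
    Waff n ω → Waff n ω → Prop
  | cyc (j : Fin n) (h : j.val = 0) :
      CycRel n ω u
        (List.ofFn fun i : Fin r => Waff.x ω j - algebraMap R (Waff n ω) (u i)).prod 0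

/-- The degenerate cyclotomic BMW algebra on `n` strands: the quotient of the degenerate affine
BMW algebra by the two-sided ideal generated by `(x_1 - u_1) ⋯ (x_1 - u_r)`. -/
abbrev Wcyc {R : Type v} [CommRing R] (n : ℕ) (ω : ℕ → R) {r : ℕ} (u : Fin r → R) : Type v :=
  RingQuot (CycRel n ω u)

/-- The image in the degenerate cyclotomic BMW algebra of an element of the free algebra. -/
def Wcyc.of {R : Type v} [CommRing R] {n : ℕ} (ω : ℕ → R) {r : ℕ} (u : Fin r → R) :
    FreeAlgebra R (Gen n) →ₐ[R] Wcyc n ω u :=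
  (RingQuot.mkAlgHom R (CycRel n ω u)).comp (RingQuot.mkAlgHom R (AffRel n ω))

/-- The element `e_1` of the two-strand degenerate cyclotomic BMW algebra. -/
def e₁ {R : Type v} [CommRing R] (ω : ℕ → R) {r : ℕ} (u : Fin r → R) : Wcyc 2 ω u :=
  Wcyc.of ω u (fe R ⟨0, by decide⟩)

/-- The element `x_1` of the two-strand degenerate cyclotomic BMW algebra. -/
def x₁ {R : Type v} [CommRing R] (ω : ℕ → R) {r : ℕ} (u : Fin r → R) : Wcyc 2 ω u :=
  Wcyc.of ω u (fx R ⟨0, by decide⟩)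

/-- `γ_i = (2 u_i - (-1)^r) ∏_{j ≠ i} (u_i + u_j) / (u_i - u_j)`. -/
def gam {F : Type v} [Field F] {r : ℕ} (u : Fin r → F) (i : Fin r) : F :=
  (2 * u i - (-1) ^ r) * ∏ j ∈ Finset.univ.erase i, (u i + u j) / (u i - u j)

end DegBMW

end

/-! Condition 3 is the hub. On such a module `x_1` has the distinct eigenvalues `u_i`, and `x_2`
acts as `-x_1` because `M` consists of the vectors `p(x_1) e_1 m`. In an eigenbasis `m_j` with `v_0
= ∑ m_j` and `e_1 m_j = g_j v_0`, the skein relation forces the entries of `s_1` to be `(g_j - δ_ij)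
/ (u_i + u_j)`. Then `s_1 v_0 = v_0` is the Cauchy system `∑_j g_j / (u_i + u_j) = 1 + 1 / (2 u_i)`.

The `γ_j` solve this system (`sum_gam_div_add`) and the solution is unique
(`eq_zero_of_sum_div_add_eq_zero`), so `g = γ`. Applying `e_1 x_1^a` to `v_0` gives 3 → 2. For 2 → 3
the same formulas define matrices satisfying all the relations (`isTwoStrand_matrix`).

Condition 1 enters through the left ideal `W e_1`, which equals `F[x_1] e_1` and is itself the
required module. Conversely, acting on a vector `m_0` with `e_1 m_0 = v_0` carries independence from
`M` back to `W e_1`. -/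

namespace DegBMW

open Polynomial

noncomputable section

/-! ### Cauchy systems and polynomial interpolation -/

section Fields

variable {F : Type v} [Field F] {r : ℕ}

/-- The vectors `(γ_j / (u_i + u_j))_i` add up to `1 + 1 / (2 u_i)`. -/
theorem sum_gam_div_add (u : Fin r → F) (hu : Function.Injective u)
    (hsum : ∀ i j, u i + u j ≠ 0) (i : Fin r) :
    ∑ j, gam u j / (u i + u j) = 1 + 1 / (u i + u i) := by
  classical
  have h2u : ∀ k, (2 : F) * u k ≠ 0 := fun k => by rw [two_mul]; exact hsum k k
  have h2 : (2 : F) ≠ 0 := left_ne_zero_of_mul (h2u i)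
  have h0 : ∀ k, u k ≠ 0 := fun k => right_ne_zero_of_mul (h2u k)
  set Q : F[X] := ∏ k ∈ Finset.univ.erase i, (X + C (u k)) with hQ
  -- The identity compares leading coefficients in Lagrange interpolation of `P`, of degree `r`, at
  -- the `r + 1` nodes `0, u_1, …, u_r`. Node `0` contributes `-1 / u_i`, node `u_j` contributes `2
  -- γ_j / (u_i + u_j)`, and the total is `2`.
  set P : F[X] := (C 2 * X + C (-(-1) ^ r)) * Q with hP
  have hcard : (Finset.univ.erase i).card + 1 = r := by
    rw [Finset.card_erase_add_one (Finset.mem_univ i), Finset.card_univ, Fintype.card_fin]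
  have hQm : Q.Monic := monic_prod_of_monic _ _ fun k _ => monic_X_add_C _
  have hQd : Q.natDegree = (Finset.univ.erase i).card := by
    rw [hQ, natDegree_prod_of_monic _ _ fun k _ => monic_X_add_C _]
    simp
  have hPl : P.leadingCoeff = 2 := by
    rw [hP, leadingCoeff_mul, hQm.leadingCoeff, leadingCoeff_linear h2, mul_one]
  have hPd : P.degree = (r : ℕ) := by
    rw [hP, degree_mul, degree_linear h2, degree_eq_natDegree hQm.ne_zero, hQd]
    exact_mod_cast (by omega : 1 + (Finset.univ.erase i).card = r)
  let v : Option (Fin r) → F := fun o => o.elim 0 u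
  have hv : Set.InjOn v (Finset.univ : Finset (Option (Fin r))) := by
    intro a _ b _ hab
    rcases a with _ | a <;> rcases b with _ | b
    · rfl
    · exact absurd hab.symm (h0 b)
    · exact absurd hab (h0 a)
    · exact congrArg some (hu hab)
  have key := Lagrange.leadingCoeff_eq_sum hv (P := P) (by rw [hPd]; simp)
  have hnone : (Finset.univ.erase (none : Option (Fin r))) = Finset.univ.map Function.Embedding.some := by
    ext a; cases a <;> simp
  have hsome : ∀ j : Fin r, (Finset.univ.erase (some j)) =
      insert none ((Finset.univ.erase j).map Function.Embedding.some) := by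
    intro j; ext a; cases a <;> simp
  have hprodn : ∏ o ∈ Finset.univ.erase none, (v none - v o) = (-1) ^ r * ∏ k, u k := by
    rw [hnone, Finset.prod_map]
    simp [v, Finset.prod_neg]
  have hprods : ∀ j : Fin r, ∏ o ∈ Finset.univ.erase (some j), (v (some j) - v o) =
      u j * ∏ k ∈ Finset.univ.erase j, (u j - u k) := by
    intro j
    rw [hsome, Finset.prod_insert (by simp), Finset.prod_map]
    simp [v]
  have hQe : ∀ z, Q.eval z = ∏ k ∈ Finset.univ.erase i, (z + u k) := fun z => by
    simp [hQ, eval_prod]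
  rw [hPl, Fintype.sum_option, hprodn] at key
  have hterm0 : eval (v none) P / ((-1) ^ r * ∏ k, u k) = -(1 / u i) := by
    have hne : ∏ k ∈ Finset.univ.erase i, u k ≠ 0 := Finset.prod_ne_zero_iff.mpr fun k _ => h0 k
    have hpow : ((-1 : F) ^ r) ≠ 0 := pow_ne_zero _ (by simp)
    have h0i := h0 i
    rw [← Finset.mul_prod_erase _ _ (Finset.mem_univ i)]
    simp only [hP, v, eval_mul, hQe, Option.elim, eval_add, eval_C, eval_X, zero_add, mul_zero]
    field_simp
  have hterm : ∀ j, eval (v (some j)) P / ∏ o ∈ Finset.univ.erase (some j), (v (some j) - v o) =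
      2 * (gam u j / (u i + u j)) := by
    intro j
    have hne : ∏ k ∈ Finset.univ.erase j, (u j - u k) ≠ 0 :=
      Finset.prod_ne_zero_iff.mpr fun k hk =>
        sub_ne_zero.mpr fun h => (Finset.mem_erase.mp hk).1 (hu h.symm)
    have hsw : (u i + u j) * ∏ k ∈ Finset.univ.erase i, (u j + u k) =
        2 * u j * ∏ k ∈ Finset.univ.erase j, (u j + u k) := by
      have h1 := Finset.mul_prod_erase Finset.univ (fun k => u j + u k) (Finset.mem_univ i)
      have h2 := Finset.mul_prod_erase Finset.univ (fun k => u j + u k) (Finset.mem_univ j)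
      rw [add_comm (u i), h1, ← h2, two_mul]
    have h0j := h0 j
    have hij := hsum i j
    rw [hprods, gam, Finset.prod_div_distrib]
    simp only [hP, v, eval_mul, hQe, Option.elim, eval_add, eval_C, eval_X]
    rw [div_eq_iff (mul_ne_zero h0j hne)]
    field_simp
    linear_combination (2 * u j - (-1) ^ r) * hsw
  rw [hterm0, Finset.sum_congr rfl fun j _ => hterm j, ← Finset.mul_sum] at key
  have h0i := h0 i
  have hii := hsum i i
  apply mul_left_cancel₀ h2
  have : (2 : F) * (1 / (u i + u i)) = 1 / u i := by
    rw [← two_mul]; field_simp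
  rw [mul_add, this]
  linear_combination -key

/-- The Cauchy matrix `1 / (u_i + u_j)` has trivial kernel. -/
theorem eq_zero_of_sum_div_add_eq_zero (u : Fin r → F) (hu : Function.Injective u)
    (hsum : ∀ i j, u i + u j ≠ 0) (c : Fin r → F)
    (hc : ∀ i, ∑ j, c j / (u i + u j) = 0) (j : Fin r) : c j = 0 := by
  classical
  -- Clearing denominators: `Q` has degree below `r`, and `Q(u_i)` is `∏ k, (u_i + u_k)` times the
  -- `i`-th equation. Hence `Q` vanishes at `r` points.
  set Q : F[X] := ∑ j, C (c j) * ∏ k ∈ Finset.univ.erase j, (X + C (u k)) with hQ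
  have hQe : ∀ z, Q.eval z = ∑ j, c j * ∏ k ∈ Finset.univ.erase j, (z + u k) := fun z => by
    simp [hQ, eval_finsetSum, eval_prod]
  have hQ0 : Q = 0 := by
    refine Polynomial.eq_zero_of_degree_lt_of_eval_index_eq_zero Finset.univ hu.injOn ?_ ?_
    · rw [Finset.card_univ, Fintype.card_fin, hQ]
      refine (degree_sum_le _ _).trans_lt ((Finset.sup_lt_iff (WithBot.bot_lt_coe r)).2 fun j _ => ?_)
      have hcard : (Finset.univ.erase j).card + 1 = r := by
        rw [Finset.card_erase_add_one (Finset.mem_univ j), Finset.card_univ, Fintype.card_fin]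
      refine (degree_mul_le _ _).trans_lt
        ((add_le_add degree_C_le (degree_prod_le _ _)).trans_lt ?_)
      simp only [degree_X_add_C, Finset.sum_const, nsmul_eq_mul, mul_one, zero_add]
      exact WithBot.coe_lt_coe.mpr (by omega : (Finset.univ.erase j).card < r)
    · intro i _
      rw [hQe]
      have : ∀ j, c j * ∏ k ∈ Finset.univ.erase j, (u i + u k) =
          (∏ k, (u i + u k)) * (c j / (u i + u j)) := fun j => by
        rw [← Finset.mul_prod_erase _ _ (Finset.mem_univ j)]
        have := hsum i j
        field_simp
      rw [Finset.sum_congr rfl fun j _ => this j, ← Finset.mul_sum, hc, mul_zero]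
  -- At `-u_j` only the `j`-th summand survives.
  have hev := hQe (-u j)
  rw [hQ0, eval_zero, Finset.sum_eq_single j] at hev
  · refine (mul_eq_zero.mp hev.symm).resolve_right (Finset.prod_ne_zero_iff.mpr fun k hk h => ?_)
    exact (Finset.mem_erase.mp hk).1 (hu (neg_add_eq_zero.mp h).symm)
  · intro k _ hk
    rw [Finset.prod_eq_zero (Finset.mem_erase.mpr ⟨hk.symm, Finset.mem_univ j⟩), mul_zero]
    simp
  · simp

theorem eq_sum_fin_of_degree_lt {q : F[X]} (hq : q.degree < (r : ℕ)) :
    q = ∑ k : Fin r, C (q.coeff k) * X ^ (k : ℕ) := by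
  rcases eq_or_ne q 0 with rfl | h0
  · simp
  · conv_lhs => rw [q.as_sum_range_C_mul_X_pow' ((natDegree_lt_iff_degree_lt h0).mpr hq)]
    exact (Fin.sum_univ_eq_sum_range (fun k => C (q.coeff k) * X ^ k) r).symm

theorem degree_modByMonic_nodal_lt (p : F[X]) (u : Fin r → F) :
    (p %ₘ Lagrange.nodal Finset.univ u).degree < (r : ℕ) := by
  simpa [Lagrange.degree_nodal] using
    degree_modByMonic_lt p (Lagrange.nodal_monic (s := Finset.univ) (v := u))

theorem eval_modByMonic_nodal (p : F[X]) (u : Fin r → F) (i : Fin r) :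
    (p %ₘ Lagrange.nodal Finset.univ u).eval (u i) = p.eval (u i) := by
  conv_rhs => rw [← modByMonic_add_div p (Lagrange.nodal Finset.univ u)]
  simp [Lagrange.eval_nodal_at_node]

end Fields


/-! ### Consequences of the relations in an arbitrary algebra -/

section Relations

variable {F : Type v} [Field F] {r : ℕ} {A : Type v} [Ring A] [Algebra F A]

/-- The elements `s`, `e`, `x`, `y` of `A` satisfy the relations imposed on `s_1`, `e_1`, `x_1`,
`x_2` in the two-strand degenerate cyclotomic BMW algebra. -/
structure IsTwoStrand (ω : ℕ → F) (u : Fin r → F) (s e x y : A) : Prop where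
  s_sq : s ^ 2 = 1
  comm : x * y = y * x
  skein_left : s * x - y * s = e - 1
  skein_right : x * s - s * y = e - 1
  unwrap : ∀ a, e * x ^ a * e = ω a • e
  e_s : e * s = e
  s_e : s * e = e
  anti_right : e * (x + y) = 0
  anti_left : (x + y) * e = 0
  cyc : aeval x (Lagrange.nodal Finset.univ u) = 0

namespace IsTwoStrand

variable {ω : ℕ → F} {u : Fin r → F} {s e x y : A} (h : IsTwoStrand ω u s e x y)

include h

/-- Since `y` commutes with `x` and `y e = -x e`, it acts on `F[x] e` as `-x`. -/
theorem y_mul_aeval_mul_e (p : F[X]) : y * (aeval x p * e) = aeval x (-(p * X)) * e := by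
  have hc : Commute y (aeval x p) := by
    induction p using Polynomial.induction_on' with
    | add p q hp hq => rw [map_add]; exact hp.add_right hq
    | monomial n a =>
      rw [aeval_monomial]
      exact (Algebra.commute_algebraMap_right _ _).mul_right (Commute.pow_right h.comm.symm n)
  have hy : y * e = -(x * e) := by
    have := h.anti_left
    rw [add_mul] at this
    exact (neg_eq_of_add_eq_zero_right this).symm
  rw [← mul_assoc, hc.eq, mul_assoc, hy, map_neg, map_mul, aeval_X, mul_neg, neg_mul, mul_assoc]

theorem exists_e_mul_aeval_mul_e (p : F[X]) : ∃ c : F, e * (aeval x p * e) = c • e := by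
  induction p using Polynomial.induction_on' with
  | add p q hp hq =>
    obtain ⟨c, hc⟩ := hp
    obtain ⟨d, hd⟩ := hq
    exact ⟨c + d, by rw [map_add, add_mul, mul_add, hc, hd, add_smul]⟩
  | monomial n a =>
    refine ⟨a * ω n, ?_⟩
    rw [aeval_monomial, ← Algebra.smul_def, smul_mul_assoc, mul_smul_comm, ← mul_assoc,
      h.unwrap, smul_smul]

/-- The skein relation `s x = y s + e - 1` moves `s` past one factor of `x` at a time. The three
terms of the new polynomial come from `y`, `e` and `-1`. -/
theorem exists_s_mul_x_pow_mul_e (k : ℕ) : ∃ q : F[X], s * (x ^ k * e) = aeval x q * e := by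
  induction k with
  | zero => exact ⟨1, by simp [h.s_e]⟩
  | succ k ih =>
    obtain ⟨q, hq⟩ := ih
    refine ⟨-(q * X) + C (ω k) - X ^ k, ?_⟩
    have hs := congrArg (· * (x ^ k * e)) h.skein_left
    simp only [sub_mul, one_mul] at hs
    rw [mul_assoc y, hq, h.y_mul_aeval_mul_e, ← mul_assoc e, h.unwrap, sub_eq_iff_eq_add] at hs
    rw [pow_succ', mul_assoc, ← mul_assoc, hs]
    simp only [map_sub, map_add, sub_mul, add_mul, aeval_C, map_pow, aeval_X, ← Algebra.smul_def]
    abel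

theorem exists_s_mul_aeval_mul_e (p : F[X]) :
    ∃ q : F[X], s * (aeval x p * e) = aeval x q * e := by
  induction p using Polynomial.induction_on' with
  | add p q hp hq =>
    obtain ⟨c, hc⟩ := hp
    obtain ⟨d, hd⟩ := hq
    exact ⟨c + d, by rw [map_add, add_mul, mul_add, hc, hd, map_add, add_mul]⟩
  | monomial n a =>
    obtain ⟨q, hq⟩ := h.exists_s_mul_x_pow_mul_e n
    refine ⟨C a * q, ?_⟩
    rw [aeval_monomial, ← Algebra.smul_def, smul_mul_assoc, mul_smul_comm, hq, map_mul, aeval_C,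
      ← Algebra.smul_def, smul_mul_assoc]

theorem exists_mul_aeval_mul_e {w : A} (hw : w ∈ Algebra.adjoin F {s, e, x, y}) (p : F[X]) :
    ∃ q : F[X], w * (aeval x p * e) = aeval x q * e := by
  induction hw using Algebra.adjoin_induction generalizing p with
  | mem w hw =>
    rcases hw with rfl | rfl | rfl | rfl
    · exact h.exists_s_mul_aeval_mul_e p
    · obtain ⟨c, hc⟩ := h.exists_e_mul_aeval_mul_e p
      exact ⟨C c, by rw [aeval_C, ← Algebra.smul_def]; exact hc⟩
    · exact ⟨X * p, by rw [map_mul, aeval_X, mul_assoc]⟩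
    · exact ⟨_, h.y_mul_aeval_mul_e p⟩
  | algebraMap c => exact ⟨C c * p, by rw [map_mul, aeval_C, mul_assoc]⟩
  | mul a b _ _ ha hb =>
    obtain ⟨q, hq⟩ := hb p
    obtain ⟨q', hq'⟩ := ha q
    exact ⟨q', by rw [mul_assoc, hq, hq']⟩
  | add a b _ _ ha hb =>
    obtain ⟨q, hq⟩ := ha p
    obtain ⟨q', hq'⟩ := hb p
    exact ⟨q + q', by rw [add_mul, hq, hq', map_add, add_mul]⟩

/-- The left ideal generated by `e` consists of the elements `p(x) e` with `p` a polynomial. -/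
theorem exists_mul_e_eq (hA : Algebra.adjoin F {s, e, x, y} = ⊤) (w : A) :
    ∃ q : F[X], w * e = aeval x q * e := by
  simpa using h.exists_mul_aeval_mul_e (w := w) (hA ▸ Algebra.mem_top) 1

theorem exists_e_mul_mul_e_eq (hA : Algebra.adjoin F {s, e, x, y} = ⊤) (w : A) :
    ∃ c : F, e * w * e = c • e := by
  obtain ⟨q, hq⟩ := h.exists_mul_e_eq hA w
  rw [mul_assoc, hq]
  exact h.exists_e_mul_aeval_mul_e q

/-! ### Modules with a basis of powers of `x` -/

section Modules

variable {M : Type v} [AddCommGroup M] [Module F M] [Module A M] [IsScalarTower F A M]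

theorem aeval_modByMonic_nodal (p : F[X]) :
    aeval x (p %ₘ Lagrange.nodal Finset.univ u) = aeval x p :=
  aeval_modByMonic_eq_self_of_root h.cyc

theorem aeval_smul_eq_sum (v₀ : M) (p : F[X]) :
    aeval x p • v₀ =
      ∑ k : Fin r, (p %ₘ Lagrange.nodal Finset.univ u).coeff k • (x ^ (k : ℕ) • v₀) := by
  rw [← h.aeval_modByMonic_nodal]
  conv_lhs => rw [eq_sum_fin_of_degree_lt (degree_modByMonic_nodal_lt p u)]
  simp [map_sum, Finset.sum_smul, ← Algebra.smul_def]

/-- The evaluation of `p(x) v₀` at `u i`, as a linear functional. -/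
theorem exists_functional {v₀ : M} (hli : LinearIndependent F fun k : Fin r => x ^ (k : ℕ) • v₀)
    (hsp : Submodule.span F (Set.range fun k : Fin r => x ^ (k : ℕ) • v₀) = ⊤) (i : Fin r) :
    ∃ φ : M →ₗ[F] F, ∀ p : F[X], φ (aeval x p • v₀) = p.eval (u i) := by
  let b := Module.Basis.mk hli hsp.ge
  -- Prescribing the values on exponents below `r` suffices: reduction modulo the nodal polynomial
  -- changes neither `p(x)` nor `p(u_i)`.
  refine ⟨b.constr F fun k => u i ^ (k : ℕ), fun p => ?_⟩
  have hb : ∀ k : Fin r, b.constr F (fun k => u i ^ (k : ℕ)) (x ^ (k : ℕ) • v₀) = u i ^ (k : ℕ) := by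
    intro k
    have := b.constr_basis F (fun k => u i ^ (k : ℕ)) k
    rwa [Module.Basis.mk_apply] at this
  rw [h.aeval_smul_eq_sum, map_sum]
  simp only [map_smul, hb, smul_eq_mul]
  conv_rhs => rw [← eval_modByMonic_nodal, eq_sum_fin_of_degree_lt (degree_modByMonic_nodal_lt p u),
    eval_finsetSum]
  simp only [eval_mul, eval_C, eval_pow, eval_X]

omit h in
theorem exists_aeval_smul_eq {v₀ : M}
    (hsp : Submodule.span F (Set.range fun k : Fin r => x ^ (k : ℕ) • v₀) = ⊤) (m : M) :
    ∃ p : F[X], m = aeval x p • v₀ := by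
  have hm : m ∈ Submodule.span F (Set.range fun k : Fin r => x ^ (k : ℕ) • v₀) := hsp ▸ trivial
  induction hm using Submodule.span_induction with
  | mem m hm =>
    obtain ⟨k, rfl⟩ := hm
    exact ⟨X ^ (k : ℕ), by simp⟩
  | zero => exact ⟨0, by simp⟩
  | add m n _ _ hm hn =>
    obtain ⟨p, rfl⟩ := hm
    obtain ⟨q, rfl⟩ := hn
    exact ⟨p + q, by rw [map_add, add_smul]⟩
  | smul c m _ hm =>
    obtain ⟨p, rfl⟩ := hm
    exact ⟨c • p, by rw [map_smul, smul_assoc]⟩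

/-- A cyclic module with a basis of powers of `x` forces the parameters to be admissible. -/
theorem eq_sum_gam (hr : 1 ≤ r) (hu : Function.Injective u) (hsum : ∀ i j, u i + u j ≠ 0) {v₀ : M}
    (hli : LinearIndependent F fun k : Fin r => x ^ (k : ℕ) • v₀)
    (hsp : Submodule.span F (Set.range fun k : Fin r => x ^ (k : ℕ) • v₀) = ⊤)
    (he : (Set.range fun m : M => e • m) = (Submodule.span F {v₀} : Set M)) (a : ℕ) :
    ω a = ∑ i, gam u i * u i ^ a := by
  classical
  have hv0 : v₀ ≠ 0 := by simpa using hli.ne_zero ⟨0, hr⟩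
  obtain ⟨m₀, hm₀⟩ : v₀ ∈ Set.range fun m : M => e • m := by
    rw [he]; exact Submodule.mem_span_singleton_self v₀
  have hev : ∀ a, e • x ^ a • v₀ = ω a • v₀ := fun a => by
    rw [← hm₀]
    simp only [← mul_smul]
    rw [← mul_assoc, h.unwrap, smul_assoc]
  have hsv : s • v₀ = v₀ := by
    rw [← hm₀]
    simp only [← mul_smul]
    rw [h.s_e]
  have hy : ∀ n : M, y • n = -(x • n) := fun n => by
    obtain ⟨p, rfl⟩ := exists_aeval_smul_eq hsp n
    rw [← hm₀]
    simp only [← mul_smul]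
    rw [h.y_mul_aeval_mul_e, mul_comm p X, map_neg, map_mul, aeval_X, neg_mul, neg_smul,
      mul_assoc]
  have hg : ∀ m : M, ∃ c : F, e • m = c • v₀ := fun m => by
    have : e • m ∈ (Submodule.span F {v₀} : Set M) := he ▸ ⟨m, rfl⟩
    obtain ⟨c, hc⟩ := Submodule.mem_span_singleton.mp this
    exact ⟨c, hc.symm⟩
  choose φ hφ using h.exists_functional hli hsp
  -- The Lagrange basis polynomials, applied to `v₀`, give the eigenvectors of `x`, with the
  -- functionals `φ i` as dual basis.
  obtain ⟨m, hm⟩ : ∃ m : Fin r → M, ∀ j, m j = aeval x (Lagrange.basis Finset.univ u j) • v₀ :=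
    ⟨_, fun _ => rfl⟩
  choose g hgm using fun j => hg (m j)
  have hφv : ∀ i, φ i v₀ = 1 := fun i => by simpa using hφ i 1
  have hφm : ∀ i j, φ i (m j) = if i = j then 1 else 0 := fun i j => by
    rw [hm, hφ]
    split_ifs with hij
    · rw [hij, Lagrange.eval_basis_self hu.injOn (Finset.mem_univ j)]
    · rw [Lagrange.eval_basis_of_ne (Ne.symm hij) (Finset.mem_univ i)]
  have hφx : ∀ i n, φ i (x • n) = u i * φ i n := fun i n => by
    obtain ⟨p, rfl⟩ := exists_aeval_smul_eq hsp n
    have : x • aeval x p • v₀ = aeval x (X * p) • v₀ := by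
      rw [map_mul, aeval_X, mul_smul]
    rw [this, hφ, hφ, eval_mul, eval_X]
  have hext : ∀ n n' : M, (∀ i, φ i n = φ i n') → n = n' := fun n n' hn => by
    obtain ⟨p, rfl⟩ := exists_aeval_smul_eq hsp n
    obtain ⟨q, rfl⟩ := exists_aeval_smul_eq hsp n'
    simp only [hφ] at hn
    have hpq : p %ₘ Lagrange.nodal Finset.univ u = q %ₘ Lagrange.nodal Finset.univ u :=
      eq_of_degrees_lt_of_eval_index_eq Finset.univ (v := u) hu.injOn
        (by simpa using degree_modByMonic_nodal_lt p u)
        (by simpa using degree_modByMonic_nodal_lt q u)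
        (fun i _ => by rw [eval_modByMonic_nodal, eval_modByMonic_nodal, hn])
    rw [← h.aeval_modByMonic_nodal p, ← h.aeval_modByMonic_nodal q, hpq]
  have hmx : ∀ j, x • m j = u j • m j := fun j => hext _ _ fun i => by
    rw [hφx, map_smul, hφm, smul_eq_mul]
    split_ifs with hij
    · rw [hij]
    · simp
  have hpow : ∀ a, x ^ a • v₀ = ∑ j, u j ^ a • m j := fun a => hext _ _ fun i => by
    have := hφ i (X ^ a)
    rw [map_pow, aeval_X] at this
    simp [this, hφm]
  -- The `i`-th coordinate of `s x - y s = e - 1` applied to `m j`, with `y` acting as `-x`.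
  have hcoef : ∀ i j, (u i + u j) * φ i (s • m j) = g j - if i = j then 1 else 0 := fun i j => by
    have hs := congrArg (fun w => φ i (w • m j)) h.skein_left
    simp only [sub_smul, one_smul, mul_smul, hy, hmx, smul_comm s (u j), hgm] at hs
    simp only [map_sub, map_neg, map_smul, hφx, hφv, hφm, smul_eq_mul, mul_one] at hs
    linear_combination hs
  have hone : ∀ i, ∑ j, g j / (u i + u j) = 1 + 1 / (u i + u i) := fun i => by
    have h1 : ∑ j, φ i (s • m j) = 1 := by
      have := hpow 0
      simp only [pow_zero, one_smul] at this
      rw [← map_sum, ← Finset.smul_sum, ← this, hsv, hφv]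
    rw [Finset.sum_congr rfl fun j _ => ((eq_div_iff (hsum i j)).mpr
      ((mul_comm _ _).trans (hcoef i j))), Finset.sum_congr rfl fun j _ => sub_div _ _ _,
      Finset.sum_sub_distrib] at h1
    have h2 : ∑ j, (if i = j then (1 : F) else 0) / (u i + u j) = 1 / (u i + u i) := by
      simp [ite_div]
    rw [← h2]
    exact sub_eq_iff_eq_add.mp h1
  have hgam : ∀ j, g j = gam u j := fun j => sub_eq_zero.mp <|
    eq_zero_of_sum_div_add_eq_zero u hu hsum (fun j => g j - gam u j) (fun i => by
      simp only [sub_div]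
      rw [Finset.sum_sub_distrib, hone, sum_gam_div_add u hu hsum, sub_self]) j
  have hω := hev a
  simp only [hpow, Finset.smul_sum, smul_comm e, hgm, smul_smul] at hω
  rw [← Finset.sum_smul] at hω
  rw [← smul_left_injective F hv0 hω]
  exact Finset.sum_congr rfl fun j _ => by rw [hgam, mul_comm]

/-- If `e x^a e = ω_a e` and `e M` is spanned by the cyclic vector, then some `ω_a` is nonzero. -/
theorem exists_omega_ne_zero (hr : 1 ≤ r) {v₀ : M}
    (hli : LinearIndependent F fun k : Fin r => x ^ (k : ℕ) • v₀)
    (hsp : Submodule.span F (Set.range fun k : Fin r => x ^ (k : ℕ) • v₀) = ⊤)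
    (he : (Set.range fun m : M => e • m) = (Submodule.span F {v₀} : Set M)) : ∃ a, ω a ≠ 0 := by
  by_contra! hω
  have hv0 : v₀ ≠ 0 := by simpa using hli.ne_zero ⟨0, hr⟩
  obtain ⟨m₀, hm₀⟩ : v₀ ∈ Set.range fun m : M => e • m := by
    rw [he]; exact Submodule.mem_span_singleton_self v₀
  have hz : ∀ m : M, e • m = 0 := fun m => by
    have hm : m ∈ Submodule.span F (Set.range fun k : Fin r => x ^ (k : ℕ) • v₀) := hsp ▸ trivial
    induction hm using Submodule.span_induction with
    | mem m hm =>
      obtain ⟨k, rfl⟩ := hm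
      simp only [← hm₀, ← mul_smul]
      rw [← mul_assoc, h.unwrap, hω, zero_smul, zero_smul]
    | zero => exact smul_zero _
    | add m n _ _ hm hn => rw [smul_add, hm, hn, add_zero]
    | smul c m _ hm => rw [smul_comm, hm, smul_zero]
  exact hv0 (hm₀.symm.trans (hz m₀))

/-- A cyclic module as in `eq_sum_gam` forces the elements `x^k e` with `k < r` to be linearly
independent, and `e A e` to be nonzero. -/
theorem linearIndependent_mul_e (hr : 1 ≤ r) {v₀ : M}
    (hli : LinearIndependent F fun k : Fin r => x ^ (k : ℕ) • v₀)
    (hsp : Submodule.span F (Set.range fun k : Fin r => x ^ (k : ℕ) • v₀) = ⊤)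
    (he : (Set.range fun m : M => e • m) = (Submodule.span F {v₀} : Set M)) :
    LinearIndependent F (fun k : Fin r => x ^ (k : ℕ) * e) ∧ ∃ w, e * w * e ≠ 0 := by
  obtain ⟨m₀, hm₀⟩ : v₀ ∈ Set.range fun m : M => e • m := by
    rw [he]; exact Submodule.mem_span_singleton_self v₀
  have hli' : LinearIndependent F fun k : Fin r => x ^ (k : ℕ) * e := by
    -- The map `a ↦ a • m₀` sends `x^k e` to `x^k v₀`.
    refine LinearIndependent.of_comp ((LinearMap.toSpanSingleton A M m₀).restrictScalars F) ?_
    convert hli using 2 with k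
    simp [← hm₀, mul_smul]
  obtain ⟨a, ha⟩ := h.exists_omega_ne_zero hr hli hsp he
  refine ⟨hli', x ^ a, ?_⟩
  rw [h.unwrap]
  exact smul_ne_zero ha (by simpa using hli'.ne_zero ⟨0, hr⟩)

/-- The left ideal generated by `e`, as a module in which `x^k e` with `k < r` is a basis. -/
theorem exists_module (hA : Algebra.adjoin F {s, e, x, y} = ⊤)
    (hli : LinearIndependent F fun k : Fin r => x ^ (k : ℕ) * e) (hw : ∃ w, e * w * e ≠ 0) :
    ∃ (M : Type v) (_ : AddCommGroup M) (_ : Module F M) (_ : Module A M)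
      (_ : IsScalarTower F A M) (v₀ : M),
      LinearIndependent F (fun k : Fin r => x ^ (k : ℕ) • v₀) ∧
      Submodule.span F (Set.range fun k : Fin r => x ^ (k : ℕ) • v₀) = ⊤ ∧
      (Set.range fun m : M => e • m) = (Submodule.span F {v₀} : Set M) := by
  obtain ⟨w, hw⟩ := hw
  let v₀ : Submodule.span A {e} := ⟨e, Submodule.mem_span_singleton_self e⟩
  refine ⟨Submodule.span A {e}, inferInstance, inferInstance, inferInstance, inferInstance, v₀,
    ?_, ?_, ?_⟩
  · exact LinearIndependent.of_comp ((Submodule.span A {e}).subtype.restrictScalars F) hli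
  · refine eq_top_iff.mpr fun m _ => ?_
    obtain ⟨b, hb⟩ := Submodule.mem_span_singleton.mp m.2
    obtain ⟨q, hq⟩ := h.exists_mul_e_eq hA b
    have : m = aeval x q • v₀ := Subtype.ext (hb.symm.trans hq)
    rw [this, h.aeval_smul_eq_sum]
    exact Submodule.sum_mem _ fun k _ =>
      Submodule.smul_mem _ _ (Submodule.subset_span (Set.mem_range_self k))
  · ext m
    simp only [Set.mem_range, SetLike.mem_coe, Submodule.mem_span_singleton]
    constructor
    · rintro ⟨n, rfl⟩
      obtain ⟨b, hb⟩ := Submodule.mem_span_singleton.mp n.2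
      obtain ⟨c, hc⟩ := h.exists_e_mul_mul_e_eq hA b
      refine ⟨c, Subtype.ext ?_⟩
      change c • e = e * (n : A)
      rw [← hb, smul_eq_mul, ← mul_assoc, hc]
    · rintro ⟨c, rfl⟩
      obtain ⟨d, hd⟩ := h.exists_e_mul_mul_e_eq hA w
      have hd0 : d ≠ 0 := fun h0 => hw (by rw [hd, h0, zero_smul])
      -- As `e w e = d e` with `d ≠ 0`, rescaling `w` reaches every multiple of `e`.
      refine ⟨((c * d⁻¹) • w) • v₀, Subtype.ext ?_⟩
      change e * (((c * d⁻¹) • w) * e) = c • e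
      rw [smul_mul_assoc, mul_smul_comm, ← mul_assoc, hd, smul_smul, inv_mul_cancel_right₀ hd0]

end Modules
end IsTwoStrand
end Relations

/-! ### The algebra `W` by generators and relations -/

section Presentation

variable {F : Type v} [Field F] {r : ℕ} (ω : ℕ → F) (u : Fin r → F)

/-- The element `s_1` of the two-strand degenerate cyclotomic BMW algebra. -/
def s₁ : Wcyc 2 ω u := Wcyc.of ω u (fs F ⟨0, by decide⟩)

/-- The element `x_2` of the two-strand degenerate cyclotomic BMW algebra. -/
def x₂ : Wcyc 2 ω u := Wcyc.of ω u (fx F ⟨1, by decide⟩)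

theorem of_rel {a b : FreeAlgebra F (Gen 2)} (h : AffRel 2 ω a b) :
    Wcyc.of ω u a = Wcyc.of ω u b := by
  simp only [Wcyc.of, AlgHom.comp_apply, RingQuot.mkAlgHom_rel F h]

theorem of_surjective : Function.Surjective (Wcyc.of ω u : FreeAlgebra F (Gen 2) → _) :=
  (RingQuot.mkAlgHom_surjective F _).comp (RingQuot.mkAlgHom_surjective F _)

theorem isTwoStrand_wcyc : IsTwoStrand ω u (s₁ ω u) (e₁ ω u) (x₁ ω u) (x₂ ω u) where
  s_sq := by simpa [s₁] using of_rel ω u (AffRel.s_sq ⟨0, by decide⟩)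
  comm := by simpa [x₁, x₂] using of_rel ω u (AffRel.x_comm ⟨0, by decide⟩ ⟨1, by decide⟩)
  skein_left := by
    simpa [x₁, x₂, s₁, e₁, lo, hi] using of_rel ω u (AffRel.skein_left ⟨0, by decide⟩)
  skein_right := by
    simpa [x₁, x₂, s₁, e₁, lo, hi] using of_rel ω u (AffRel.skein_right ⟨0, by decide⟩)
  unwrap a := by
    rcases Nat.eq_zero_or_pos a with rfl | ha
    · simpa [e₁, pow_two] using of_rel ω u (AffRel.e_sq ⟨0, by decide⟩)
    · simpa [x₁, e₁, lo] using of_rel ω u (AffRel.unwrap ⟨0, by decide⟩ rfl a ha)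
  e_s := by simpa [s₁, e₁] using of_rel ω u (AffRel.e_s ⟨0, by decide⟩)
  s_e := by simpa [s₁, e₁] using of_rel ω u (AffRel.s_e ⟨0, by decide⟩)
  anti_right := by
    simpa [x₁, x₂, e₁, lo, hi] using of_rel ω u (AffRel.anti_right ⟨0, by decide⟩)
  anti_left := by
    simpa [x₁, x₂, e₁, lo, hi] using of_rel ω u (AffRel.anti_left ⟨0, by decide⟩)
  cyc := by
    have h := RingQuot.mkAlgHom_rel F (CycRel.cyc (ω := ω) (u := u) (⟨0, by decide⟩ : Fin 2) rfl)
    rw [Lagrange.nodal, ← List.prod_ofFn, map_list_prod, List.map_ofFn]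
    rw [map_zero, map_list_prod, List.map_ofFn] at h
    convert h using 3
    ext i
    simp [x₁, Wcyc.of, Waff.x]

theorem adjoin_wcyc : Algebra.adjoin F {s₁ ω u, e₁ ω u, x₁ ω u, x₂ ω u} = ⊤ := by
  refine Algebra.eq_top_iff.mpr fun w => ?_
  obtain ⟨a, rfl⟩ := of_surjective ω u w
  induction a using FreeAlgebra.induction with
  | grade0 c => rw [AlgHom.commutes]; exact Subalgebra.algebraMap_mem _ _
  | grade1 g =>
    apply Algebra.subset_adjoin
    rcases g with i | i | j
    · obtain rfl : i = ⟨0, by decide⟩ := Subsingleton.elim (α := Fin 1) _ _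
      exact Or.inl rfl
    · obtain rfl : i = ⟨0, by decide⟩ := Subsingleton.elim (α := Fin 1) _ _
      exact Or.inr (Or.inl rfl)
    · fin_cases j
      · exact Or.inr (Or.inr (Or.inl rfl))
      · exact Or.inr (Or.inr (Or.inr rfl))
  | mul a b ha hb => rw [map_mul]; exact mul_mem ha hb
  | add a b ha hb => rw [map_add]; exact add_mem ha hb

variable {ω u} {A : Type v} [Ring A] [Algebra F A] {s e x y : A}

/-- The values of the generators under the homomorphism given by a solution of the relations. -/
def genValue (s e x y : A) : Gen 2 → A
  | Gen.s _ => s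
  | Gen.e _ => e
  | Gen.x j => if j.val = 0 then x else y

/-- The universal property of the two-strand degenerate cyclotomic BMW algebra. -/
theorem IsTwoStrand.exists_algHom (h : IsTwoStrand ω u s e x y) :
    ∃ f : Wcyc 2 ω u →ₐ[F] A, f (e₁ ω u) = e ∧ f (x₁ ω u) = x := by
  let f₀ : FreeAlgebra F (Gen 2) →ₐ[F] A := FreeAlgebra.lift F (genValue s e x y)
  have hs : ∀ i, f₀ (fs F i) = s := fun i => by simp [f₀, genValue]
  have he : ∀ i, f₀ (fe F i) = e := fun i => by simp [f₀, genValue]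
  have hx : ∀ i, f₀ (fx F (lo i)) = x := fun i => by
    have := i.2
    simp [f₀, genValue, lo]
  have hy : ∀ i, f₀ (fx F (hi i)) = y := fun i => by simp [f₀, genValue, hi]
  have h₁ : ∀ ⦃a b⦄, AffRel 2 ω a b → f₀ a = f₀ b := by
    -- On two strands there is a single index `i`, so every relation involving distant or
    -- consecutive indices, or a third strand, is vacuous.
    have hfar : ∀ i j : Fin (2 - 1), ¬ Far i j := fun i j hij => by
      have := i.2; have := j.2; simp only [Far] at hij; omega
    have hne : ∀ (i : Fin (2 - 1)) (j : Fin 2), j ≠ lo i → j ≠ hi i → False := fun i j a b => by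
      have := i.2; have := j.2; simp only [lo, hi, ne_eq, Fin.ext_iff] at a b; omega
    have hsucc : ∀ i k : Fin (2 - 1), k.val ≠ i.val + 1 := fun i k => by
      have := i.2; have := k.2; omega
    intro a b hab
    cases hab with
    | s_sq i => rw [map_pow, hs, h.s_sq, map_one]
    | s_comm i j hij => exact absurd hij (hfar i j)
    | braid i k hik => exact absurd hik (hsucc i k)
    | s_x_comm i j a b => exact (hne i j a b).elim
    | e_sq i => simpa [he, pow_two] using h.unwrap 0
    | s_e_comm i j hij => exact absurd hij (hfar i j)
    | e_comm i j hij => exact absurd hij (hfar i j)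
    | e_x_comm i j a b => exact (hne i j a b).elim
    | x_comm i j =>
      have hxy : ∀ i : Fin 2, f₀ (fx F i) = x ∨ f₀ (fx F i) = y := fun i => by
        simp only [f₀, fx, FreeAlgebra.lift_ι_apply, genValue]
        exact ite_eq_or_eq _ _ _
      rw [map_mul, map_mul]
      rcases hxy i with hi | hi <;> rcases hxy j with hj | hj <;> simp [hi, hj, h.comm]
    | skein_left i => simp only [map_sub, map_mul, hs, he, hx, hy, map_one, h.skein_left]
    | skein_right i => simp only [map_sub, map_mul, hs, he, hx, hy, map_one, h.skein_right]
    | unwrap i _ a _ => simp only [map_mul, map_pow, he, hx, map_smul, h.unwrap]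
    | e_s i => rw [map_mul, hs, he, h.e_s]
    | s_e i => rw [map_mul, hs, he, h.s_e]
    | tangle₁ i k hik => exact absurd hik (hsucc i k)
    | tangle₂ i k hik => exact absurd hik (hsucc i k)
    | tangle₃ i k hik => exact absurd hik (hsucc i k)
    | tangle₄ i k hik => exact absurd hik (hsucc i k)
    | untwist₁ i k hik => exact absurd hik (hsucc i k)
    | untwist₂ i k hik => exact absurd hik (hsucc i k)
    | anti_right i => simp only [map_mul, map_add, he, hx, hy, h.anti_right, map_zero]
    | anti_left i => simp only [map_mul, map_add, he, hx, hy, h.anti_left, map_zero]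
  let f₁ : Waff 2 ω →ₐ[F] A := RingQuot.liftAlgHom F ⟨f₀, h₁⟩
  have hf₁ : ∀ a, f₁ (RingQuot.mkAlgHom F _ a) = f₀ a := fun a =>
    RingQuot.liftAlgHom_mkAlgHom_apply F f₀ h₁ a
  have h₂ : ∀ ⦃a b⦄, CycRel 2 ω u a b → f₁ a = f₁ b := by
    intro a b hab
    cases hab with
    | cyc j hj =>
      have hcyc := h.cyc
      rw [Lagrange.nodal, ← List.prod_ofFn, map_list_prod, List.map_ofFn] at hcyc
      rw [map_zero, map_list_prod, List.map_ofFn, ← hcyc]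
      congr 2
      ext i
      simp only [Function.comp_apply, map_sub, AlgHom.commutes, Waff.x, hf₁, aeval_X, aeval_C]
      simp [f₀, genValue, hj]
  let f₂ : Wcyc 2 ω u →ₐ[F] A := RingQuot.liftAlgHom F ⟨f₁, h₂⟩
  have hf₂ : ∀ a, f₂ (Wcyc.of ω u a) = f₀ a := fun a => by
    rw [← hf₁]
    exact RingQuot.liftAlgHom_mkAlgHom_apply F f₁ h₂ _
  exact ⟨f₂, (hf₂ _).trans (he _), (hf₂ _).trans (hx ⟨0, by decide⟩)⟩

end Presentation

/-! ### The matrix model for admissible parameters -/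

section Construction

open Matrix

variable {F : Type v} [Field F] {r : ℕ}

/-- The matrix of `e_1` in the eigenbasis of `x_1`. -/
def matE (u : Fin r → F) : Matrix (Fin r) (Fin r) F := of fun _ j => gam u j

/-- The matrix of `s_1` in the eigenbasis of `x_1`. -/
def matS (u : Fin r → F) : Matrix (Fin r) (Fin r) F :=
  of fun i j => (gam u j - if i = j then 1 else 0) / (u i + u j)

theorem isTwoStrand_matrix {ω : ℕ → F} {u : Fin r → F} (hu : Function.Injective u)
    (hsum : ∀ i j, u i + u j ≠ 0) (hω : ∀ a, ω a = ∑ i, gam u i * u i ^ a) :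
    IsTwoStrand ω u (matS u) (matE u) (diagonal u) (-diagonal u) := by
  -- By the Cauchy identity, `matS u` fixes the all-ones vector, which spans the image of `matE u`
  -- when `γ ≠ 0`.
  have hrow : ∀ i, ∑ j, matS u i j = 1 := fun i => by
    have h2 : ∑ j, (if i = j then (1 : F) else 0) / (u i + u j) = 1 / (u i + u i) := by
      simp [ite_div]
    simp only [matS, of_apply, sub_div]
    rw [Finset.sum_sub_distrib, h2, sum_gam_div_add u hu hsum, add_sub_cancel_right]
  have hskew : matS u * diagonal u + diagonal u * matS u = matE u - 1 := by
    ext i j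
    have := hsum i j
    simp only [matS, matE, Matrix.add_apply, mul_diagonal, diagonal_mul, Matrix.sub_apply, of_apply, one_apply]
    field_simp
    ring
  have hse : matS u * matE u = matE u := by
    ext i j
    simp only [mul_apply, matE, of_apply]
    rw [← Finset.sum_mul, hrow, one_mul]
  have hes : matE u * matS u = matE u := by
    ext i j
    -- This symmetry turns the row sums of `matS u` into the statement that the row vector `γ` is
    -- fixed by it.
    have hterm : ∀ k, gam u k * matS u k j = gam u j * matS u j k := fun k => by
      simp only [matS, of_apply]
      rcases eq_or_ne k j with rfl | hkj
      · rfl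
      · rw [if_neg hkj, if_neg hkj.symm, add_comm (u k)]; ring
    simp only [mul_apply, matE, of_apply]
    rw [Finset.sum_congr rfl fun k _ => hterm k, ← Finset.mul_sum, hrow, mul_one]
  have hsq : matS u * matS u = 1 := by
    -- Multiplying `S D + D S = E - 1` by `S` on either side gives `E - S` both times, so `S²`
    -- commutes with `D`. The entries of `D` are distinct, so `S²` is diagonal, and its row sums are
    -- `1`.
    have hcomm : matS u * matS u * diagonal u = diagonal u * (matS u * matS u) := by
      have h1 := congrArg (matS u * ·) hskew
      have h2 := congrArg (· * matS u) hskew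
      simp only [mul_add, add_mul, mul_sub, sub_mul, hse, hes, mul_one, one_mul,
        ← mul_assoc] at h1 h2
      rw [← mul_assoc]
      exact add_right_cancel (h1.trans (h2.symm.trans (add_comm _ _)))
    have hoff : ∀ i j, i ≠ j → (matS u * matS u) i j = 0 := fun i j hij => by
      have h1 := congrFun (congrFun hcomm i) j
      rw [mul_diagonal, diagonal_mul] at h1
      have h2 : (u j - u i) * (matS u * matS u) i j = 0 := by linear_combination h1
      exact (mul_eq_zero.mp h2).resolve_left (sub_ne_zero.mpr fun h => hij (hu h.symm))
    have hsqrow : ∀ i, ∑ j, (matS u * matS u) i j = 1 := fun i => by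
      simp only [mul_apply]
      rw [Finset.sum_comm]
      simp only [← Finset.mul_sum, hrow, mul_one]
    ext i j
    rcases eq_or_ne i j with rfl | hij
    · rw [one_apply_eq, ← hsqrow i, Finset.sum_eq_single i]
      · exact fun j _ hj => hoff i j hj.symm
      · simp
    · rw [hoff i j hij, one_apply_ne hij]
  exact
    { s_sq := by rw [pow_two, hsq]
      comm := by rw [mul_neg, neg_mul]
      skein_left := by rw [neg_mul, sub_neg_eq_add, hskew]
      skein_right := by rw [mul_neg, sub_neg_eq_add, add_comm, hskew]
      unwrap := fun a => by
        ext i j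
        rw [diagonal_pow, mul_apply, Matrix.smul_apply, smul_eq_mul, hω, Finset.sum_mul]
        simp [mul_diagonal, matE]
      e_s := hes
      s_e := hse
      anti_right := by rw [add_neg_cancel, mul_zero]
      anti_left := by rw [add_neg_cancel, zero_mul]
      cyc := by
        have hdiag : ∀ p : F[X], aeval (diagonal u) p = diagonal fun i => p.eval (u i) := fun p => by
          induction p using Polynomial.induction_on' with
          | add p q hp hq => simp [hp, hq]
          | monomial n a =>
            rw [aeval_monomial, diagonal_pow, Matrix.algebraMap_eq_diagonal, diagonal_mul_diagonal]
            simp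
        rw [hdiag, ← diagonal_zero]
        exact congrArg diagonal (funext fun i => Lagrange.eval_nodal_at_node (Finset.mem_univ i)) }

/-- For admissible parameters, `F^r` is a cyclic module with a basis of powers of `x_1`. -/
theorem exists_module_of_eq_sum_gam {ω : ℕ → F} {u : Fin r → F} (hu : Function.Injective u)
    (hsum : ∀ i j, u i + u j ≠ 0) (hω : ∀ a, ω a = ∑ i, gam u i * u i ^ a) (h0 : ∃ a, ω a ≠ 0) :
    ∃ (M : Type v) (_ : AddCommGroup M) (_ : Module F M) (_ : Module (Wcyc 2 ω u) M)
      (_ : IsScalarTower F (Wcyc 2 ω u) M) (v₀ : M),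
      LinearIndependent F (fun k : Fin r => x₁ ω u ^ (k : ℕ) • v₀) ∧
      Submodule.span F (Set.range fun k : Fin r => x₁ ω u ^ (k : ℕ) • v₀) = ⊤ ∧
      (Set.range fun m : M => e₁ ω u • m) = (Submodule.span F {v₀} : Set M) := by
  obtain ⟨f, hfe, hfx⟩ := (isTwoStrand_matrix hu hsum hω).exists_algHom
  let g : Wcyc 2 ω u →ₐ[F] Module.End F (Fin r → F) := (Matrix.toLinAlgEquiv' : _ ≃ₐ[F] _).toAlgHom.comp f
  let _ : Module (Wcyc 2 ω u) (Fin r → F) := Module.compHom _ g.toRingHom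
  have hsmul : ∀ (w : Wcyc 2 ω u) (m : Fin r → F), w • m = f w *ᵥ m := fun w m => rfl
  have : IsScalarTower F (Wcyc 2 ω u) (Fin r → F) :=
    ⟨fun c w m => by rw [hsmul, hsmul, map_smul, smul_mulVec]⟩
  have hx : ∀ k : ℕ, x₁ ω u ^ k • (1 : Fin r → F) = fun i => u i ^ k := fun k => by
    rw [hsmul, map_pow, hfx, diagonal_pow]
    ext i
    simp [mulVec_diagonal]
  have hli : LinearIndependent F fun k : Fin r => x₁ ω u ^ (k : ℕ) • (1 : Fin r → F) := by
    simp only [hx]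
    -- The vectors `x₁^k • 1` are the columns of the Vandermonde matrix of `u`.
    exact linearIndependent_cols_of_det_ne_zero (det_vandermonde_ne_zero_iff.mpr hu)
  have he : ∀ m : Fin r → F, e₁ ω u • m = (∑ j, gam u j * m j) • (1 : Fin r → F) := fun m => by
    rw [hsmul, hfe]
    ext i
    simp [matE, mulVec, dotProduct]
  refine ⟨Fin r → F, inferInstance, inferInstance, inferInstance, inferInstance, 1, hli, ?_, ?_⟩
  · exact hli.span_eq_top_of_card_eq_finrank' (by simp)
  · ext m
    simp only [Set.mem_range, SetLike.mem_coe, Submodule.mem_span_singleton, he]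
    constructor
    · rintro ⟨n, rfl⟩
      exact ⟨_, rfl⟩
    · rintro ⟨c, rfl⟩
      obtain ⟨a, ha⟩ := h0
      -- The vector `x₁^a • 1` is sent by `e₁` to `ω a • 1`, and `ω a` is invertible.
      refine ⟨(c * (ω a)⁻¹) • fun i => u i ^ a, ?_⟩
      congr 1
      simp only [Pi.smul_apply, smul_eq_mul, mul_left_comm (gam u _)]
      rw [← Finset.mul_sum, ← hω, inv_mul_cancel_right₀ ha]

end Construction

end

end DegBMW

theorem mainTheorem4 {F : Type v} [Field F] (hchar : ringChar F ≠ 2)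
    (r : ℕ) (hr : 1 ≤ r) (ω : ℕ → F) (u : Fin r → F)
    (hu : Function.Injective u) (hsum : ∀ i j : Fin r, u i + u j ≠ 0) :
    List.TFAE [
      LinearIndependent F (fun k : Fin r => DegBMW.x₁ ω u ^ (k : ℕ) * DegBMW.e₁ ω u) ∧
        ∃ w : DegBMW.Wcyc 2 ω u, DegBMW.e₁ ω u * w * DegBMW.e₁ ω u ≠ 0,
      (∀ a : ℕ, ω a = ∑ i : Fin r, DegBMW.gam u i * u i ^ a) ∧ ∃ a : ℕ, ω a ≠ 0,
      ∃ (M : Type v) (_ : AddCommGroup M) (_ : Module F M) (_ : Module (DegBMW.Wcyc 2 ω u) M)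
        (_ : IsScalarTower F (DegBMW.Wcyc 2 ω u) M) (v₀ : M),
        LinearIndependent F (fun k : Fin r => DegBMW.x₁ ω u ^ (k : ℕ) • v₀) ∧
        Submodule.span F (Set.range fun k : Fin r => DegBMW.x₁ ω u ^ (k : ℕ) • v₀) = ⊤ ∧
        (Set.range fun m : M => DegBMW.e₁ ω u • m) = (Submodule.span F {v₀} : Set M)] := by
  have h := DegBMW.isTwoStrand_wcyc ω u
  have hA := DegBMW.adjoin_wcyc ω u
  tfae_have 1 → 3 := fun ⟨hli, hw⟩ => h.exists_module hA hli hw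
  tfae_have 3 → 2 := fun ⟨M, _, _, _, _, v₀, hli, hsp, he⟩ =>
    ⟨h.eq_sum_gam hr hu hsum hli hsp he,
      h.exists_omega_ne_zero hr hli hsp he⟩
  tfae_have 2 → 3 := fun ⟨hω, h0⟩ => DegBMW.exists_module_of_eq_sum_gam hu hsum hω h0
  tfae_have 3 → 1 := fun ⟨M, _, _, _, _, v₀, hli, hsp, he⟩ =>
    h.linearIndependent_mul_e hr hli hsp he
  tfae_finish
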